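/- All graphs are finite, simple and undirected. The rank and the spectral radius of a graph are the rank and the spectral radius of its adjacency matrix. For a graph $H$ with vertices $v_1,\dots,v_k$ and a vector $\mathbf m=(n_1,\dots,n_k)$ of positive integers, let $H\circ\mathbf m$ be the graph obtained from $H$ by replacing each vertex $v_i$ with an independent set $V_i$ of $n_i$ vertices and joining each vertex of $V_i$ to each vertex of $V_j$ if and only if $v_iv_j\in E(H)$. Let $M_n(H)$ be the set of all graphs isomorphic to $H\circ(n_1,\dots,n_k)$ for some positive integers $n_i$ with $\sum_{i=1}^k n_i=n$, and let $M_n(H_1,\dots,H_l)=\bigcup_{i=1}^l M_n(H_i)$. Let $G_1$ be the graph on $v_1,\dots,v_5$ with edges $v_1v_2, v_1v_3, v_1v_4, v_2v_4, v_3v_5$; let $G_7=C_5$ be the cycle on five vertices; and let $G_{10}$ be the graph on $v_1,\dots,v_6$ with edges $v_1v_2, v_1v_3, v_1v_4, v_2v_3, v_2v_5, v_3v_5, v_4v_6$. **Proposition.** Let $G$ be a graph that attains the minimum spectral radius among all connected graphs of order $n$ and rank $5$. Then $G\in M_n(G_1,G_7,G_{10})$. -/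

import Mathlib

open scoped Classical in
/-- The rank of a finite graph: the rank of its adjacency matrix. -/
noncomputable def SimpleGraph.adjRank {V : Type*} [Fintype V] (G : SimpleGraph V) : ℕ :=
  (G.adjMatrix ℝ).rank

open scoped Classical in
/-- The spectral radius of a finite graph: the spectral radius of its adjacency matrix. The
adjacency matrix is real symmetric, so all its eigenvalues are real. -/
noncomputable def SimpleGraph.adjSpectralRadius {V : Type*} [Fintype V] (G : SimpleGraph V) :
    ENNReal :=
  spectralRadius ℝ (G.adjMatrix ℝ)

/-- `H ∘ m`: each vertex `i` of `H` is replaced by an independent set of `m i` vertices, and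
`(i, a)`, `(j, b)` are adjacent if and only if `i`, `j` are adjacent in `H`. -/
def SimpleGraph.vertexMul {W : Type*} (H : SimpleGraph W) (m : W → ℕ) :
    SimpleGraph (Σ i : W, Fin (m i)) where
  Adj x y := H.Adj x.1 y.1
  symm := ⟨fun _ _ h => h.symm⟩
  loopless := ⟨fun x h => H.loopless.irrefl x.1 h⟩

/-- `M_n(H)`, as a set of graphs on the vertex type `V`: the graphs isomorphic to `H ∘ m` for a
vector `m` of positive integers with sum `n`. -/
def SimpleGraph.mulSet {W : Type*} [Fintype W] (V : Type*) (n : ℕ) (H : SimpleGraph W) :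
    Set (SimpleGraph V) :=
  {G | ∃ m : W → ℕ, (∀ i, 0 < m i) ∧ ∑ i, m i = n ∧ Nonempty (G ≃g H.vertexMul m)}

/-- `G` attains the minimum spectral radius among all connected graphs of rank `r` on the
vertex type of `G`, hence, up to isomorphism, among all connected graphs of rank `r` that have
the order of `G`. -/
def SimpleGraph.IsMinSpectralRadius {V : Type*} [Fintype V] (r : ℕ) (G : SimpleGraph V) : Prop :=
  G.Connected ∧ G.adjRank = r ∧
    ∀ H : SimpleGraph V, H.Connected → H.adjRank = r →
      G.adjSpectralRadius ≤ H.adjSpectralRadius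

/-- The reduced graph `G₁`: a triangle `v₁v₂v₄` with a path `v₁v₃v₅` attached at `v₁`
(vertex `vᵢ` is `i - 1`). -/
def reducedG1 : SimpleGraph (Fin 5) :=
  SimpleGraph.fromEdgeSet {s(0, 1), s(0, 2), s(0, 3), s(1, 3), s(2, 4)}

/-- The reduced graph `G₇`: the cycle `C₅`. -/
def reducedG7 : SimpleGraph (Fin 5) := SimpleGraph.cycleGraph 5

/-- The reduced graph `G₁₀`: the two triangles `v₁v₂v₃` and `v₂v₃v₅` sharing the edge `v₂v₃`,
with a path `v₁v₄v₆` attached at `v₁` (vertex `vᵢ` is `i - 1`). -/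
def reducedG10 : SimpleGraph (Fin 6) :=
  SimpleGraph.fromEdgeSet
    {s(0, 1), s(0, 2), s(0, 3), s(1, 2), s(1, 4), s(2, 4), s(3, 5)}

/-!
By the Perron–Frobenius theorem, the spectral radius of a connected graph `G` is greater than that
of each proper spanning subgraph. Hence, if `G` minimizes the spectral radius, it is equal to every
connected spanning subgraph that has the same rank, and it suffices to find a spanning blow-up of
`G₁`, `C₅` or `G₁₀` in each connected graph of rank `5`.

Choose five vertices that induce a nonsingular graph `F` with as few edges as possible. If `C`
consists of the columns of the adjacency matrix `A` of `G` at these vertices, then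
`A = C F⁻¹ Cᵀ`: whether two vertices are adjacent depends only on their traces, that is, on their
neighbourhoods among the five vertices. The zero diagonal of `A` and the choice of `F` (a vertex can
be exchanged for another one whenever the corresponding coefficient is nonzero) leave few traces.
A nonsingular graph on five vertices is `C₅`, or `K₃ ∪ K₂`, or contains `G₁`. Correspondingly, the
traces can be partitioned into the classes of a blow-up of `C₅`, of `G₁₀` or of `G₁`; for `K₃ ∪ K₂`,
the connectedness of `G` first provides a vertex that joins the two components.
-/

open Matrix Finset

namespace RankFive

section SpectralRadius

variable {V : Type*} [Fintype V]

theorem abs_dotProduct_mulVec_le {A : Matrix V V ℝ} (hA : ∀ i j, 0 ≤ A i j) (y : V → ℝ) :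
    |y ⬝ᵥ A *ᵥ y| ≤ |y| ⬝ᵥ A *ᵥ |y| := by
  simp only [dotProduct, mulVec, mul_sum]
  refine (abs_sum_le_sum_abs _ _).trans (sum_le_sum fun i _ =>
    (abs_sum_le_sum_abs _ _).trans (sum_le_sum fun j _ => ?_))
  rw [abs_mul, abs_mul, abs_of_nonneg (hA i j)]
  rfl

variable [DecidableEq V]

theorem spectralRadius_ne_top (A : Matrix V V ℝ) : spectralRadius ℝ A ≠ ⊤ := by
  obtain ⟨C, hC⟩ := (A.finite_real_spectrum.image fun k => ‖k‖₊).bddAbove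
  have h : spectralRadius ℝ A ≤ C :=
    iSup₂_le fun k hk => by exact_mod_cast hC (Set.mem_image_of_mem _ hk)
  exact (h.trans_lt ENNReal.coe_lt_top).ne

theorem abs_le_toReal_spectralRadius {A : Matrix V V ℝ} {k : ℝ} (hk : k ∈ spectrum ℝ A) :
    |k| ≤ (spectralRadius ℝ A).toReal := by
  simpa using ENNReal.toReal_mono (spectralRadius_ne_top A)
    (le_iSup₂ (f := fun k _ => (‖k‖₊ : ENNReal)) k hk)

theorem exists_mem_spectrum_abs_eq_spectralRadius [Nonempty V] {A : Matrix V V ℝ}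
    (hA : A.IsHermitian) : ∃ k ∈ spectrum ℝ A, |k| = (spectralRadius ℝ A).toReal := by
  have hne : (spectrum ℝ A).Nonempty := by
    rw [hA.spectrum_real_eq_range_eigenvalues]
    exact Set.range_nonempty _
  obtain ⟨k, hk, hmax⟩ := A.finite_real_spectrum.exists_maximalFor (fun k : ℝ => |k|) _ hne
  have hle : spectralRadius ℝ A ≤ (‖k‖₊ : ENNReal) := iSup₂_le fun l hl => by
    exact_mod_cast (le_total |l| |k|).elim id (hmax hl)
  refine ⟨k, hk, le_antisymm (abs_le_toReal_spectralRadius hk) ?_⟩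
  simpa using ENNReal.toReal_mono ENNReal.coe_ne_top hle

theorem exists_mulVec_eq_smul_of_mem_spectrum {A : Matrix V V ℝ} {k : ℝ}
    (hk : k ∈ spectrum ℝ A) : ∃ y : V → ℝ, y ≠ 0 ∧ A *ᵥ y = k • y := by
  rw [spectrum.mem_iff, isUnit_iff_isUnit_det, isUnit_iff_ne_zero, not_not] at hk
  obtain ⟨y, hy, h⟩ := exists_mulVec_eq_zero_iff.2 hk
  refine ⟨y, hy, ?_⟩
  rw [sub_mulVec, sub_eq_zero, Algebra.algebraMap_eq_smul_one, smul_mulVec, one_mulVec] at h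
  exact h.symm

theorem posSemidef_spectralRadius_smul_one_sub {A : Matrix V V ℝ} (hA : A.IsHermitian) :
    ((spectralRadius ℝ A).toReal • 1 - A).PosSemidef := by
  rw [← Algebra.algebraMap_eq_smul_one, posSemidef_iff_isHermitian_and_spectrum_nonneg]
  constructor
  · rw [algebraMap_eq_diagonal]
    exact (isHermitian_diagonal _).sub hA
  · rw [← spectrum.singleton_sub_eq]
    rintro _ ⟨_, rfl, k, hk, rfl⟩
    exact sub_nonneg.2 ((le_abs_self k).trans (abs_le_toReal_spectralRadius hk))

theorem dotProduct_smul_one_sub_mulVec (A : Matrix V V ℝ) (r : ℝ) (x : V → ℝ) :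
    x ⬝ᵥ (r • 1 - A) *ᵥ x = r * (x ⬝ᵥ x) - x ⬝ᵥ A *ᵥ x := by
  rw [sub_mulVec, dotProduct_sub, smul_mulVec, one_mulVec, dotProduct_smul, smul_eq_mul]

theorem dotProduct_mulVec_le_spectralRadius_mul {A : Matrix V V ℝ} (hA : A.IsHermitian)
    (x : V → ℝ) : x ⬝ᵥ A *ᵥ x ≤ (spectralRadius ℝ A).toReal * (x ⬝ᵥ x) := by
  rw [← sub_nonneg, ← dotProduct_smul_one_sub_mulVec]
  simpa using (posSemidef_spectralRadius_smul_one_sub hA).dotProduct_mulVec_nonneg x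

theorem mulVec_eq_of_spectralRadius_mul_le {A : Matrix V V ℝ} (hA : A.IsHermitian) {x : V → ℝ}
    (h : (spectralRadius ℝ A).toReal * (x ⬝ᵥ x) ≤ x ⬝ᵥ A *ᵥ x) :
    A *ᵥ x = (spectralRadius ℝ A).toReal • x := by
  have h0 := sub_eq_zero.2 (h.antisymm (dotProduct_mulVec_le_spectralRadius_mul hA x))
  have := ((posSemidef_spectralRadius_smul_one_sub hA).dotProduct_mulVec_zero_iff x).1
    (by rw [star_trivial, dotProduct_smul_one_sub_mulVec, h0])
  rw [sub_mulVec, sub_eq_zero, smul_mulVec, one_mulVec] at this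
  exact this.symm

theorem exists_nonneg_mulVec_eq_spectralRadius_smul [Nonempty V] {A : Matrix V V ℝ}
    (hA : A.IsHermitian) (hA0 : ∀ i j, 0 ≤ A i j) :
    ∃ x : V → ℝ, 0 ≤ x ∧ x ≠ 0 ∧ A *ᵥ x = (spectralRadius ℝ A).toReal • x := by
  obtain ⟨k, hk, hkr⟩ := exists_mem_spectrum_abs_eq_spectralRadius hA
  obtain ⟨y, hy0, hy⟩ := exists_mulVec_eq_smul_of_mem_spectrum hk
  have hyy : 0 ≤ y ⬝ᵥ y := dotProduct_star_self_nonneg y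
  refine ⟨|y|, abs_nonneg y, by simpa using hy0, mulVec_eq_of_spectralRadius_mul_le hA ?_⟩
  calc (spectralRadius ℝ A).toReal * (|y| ⬝ᵥ |y|)
      = |y ⬝ᵥ A *ᵥ y| := by
        rw [hy, dotProduct_smul, smul_eq_mul, abs_mul, hkr, abs_of_nonneg hyy]
        simp [dotProduct]
    _ ≤ |y| ⬝ᵥ A *ᵥ |y| := abs_dotProduct_mulVec_le hA0 y

end SpectralRadius

section AdjMatrix

variable {V : Type*} {G G' : SimpleGraph V} [DecidableRel G.Adj] [DecidableRel G'.Adj]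

theorem ite_adj_le_ite_adj (h : G' ≤ G) {x : V → ℝ} (hx : 0 ≤ x) (i j : V) :
    (if G'.Adj i j then x i * x j else 0) ≤ if G.Adj i j then x i * x j else 0 := by
  have := mul_nonneg (hx i) (hx j)
  split_ifs with h' hG
  exacts [le_rfl, absurd (h h') hG, this, le_rfl]

variable [Fintype V]

theorem pos_of_adjMatrix_mulVec_eq_smul (hG : G.Connected) {x : V → ℝ} (hx : 0 ≤ x)
    (hx0 : x ≠ 0) {r : ℝ} (h : G.adjMatrix ℝ *ᵥ x = r • x) (v : V) : 0 < x v := by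
  have eq_zero_of_adj {u w : V} (huw : G.Adj u w) (hu : x u = 0) : x w = 0 := by
    have hsum := congrFun h u
    rw [SimpleGraph.adjMatrix_mulVec_apply, Pi.smul_apply, hu, smul_zero] at hsum
    exact (sum_eq_zero_iff_of_nonneg fun i _ => hx i).1 hsum w (by simpa using huw)
  refine (hx v).lt_of_ne' fun hv => hx0 (funext fun w => by_contra fun hw => ?_)
  obtain ⟨p⟩ := hG.preconnected v w
  obtain ⟨d, -, hfst, hsnd⟩ := p.exists_boundary_dart {u | x u = 0} hv hw
  exact hsnd (eq_zero_of_adj d.adj hfst)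

theorem dotProduct_adjMatrix_mulVec (x : V → ℝ) :
    x ⬝ᵥ G.adjMatrix ℝ *ᵥ x = ∑ i, ∑ j, if G.Adj i j then x i * x j else 0 := by
  simp only [dotProduct, mulVec, mul_sum, SimpleGraph.adjMatrix_apply, ite_mul, one_mul, zero_mul,
    mul_ite, mul_zero]

theorem dotProduct_adjMatrix_mulVec_mono (h : G' ≤ G) {x : V → ℝ} (hx : 0 ≤ x) :
    x ⬝ᵥ G'.adjMatrix ℝ *ᵥ x ≤ x ⬝ᵥ G.adjMatrix ℝ *ᵥ x := by
  simp only [dotProduct_adjMatrix_mulVec]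
  exact sum_le_sum fun i _ => sum_le_sum fun j _ => ite_adj_le_ite_adj h hx i j

theorem dotProduct_adjMatrix_mulVec_strictMono (h : G' < G) {x : V → ℝ} (hx : ∀ i, 0 < x i) :
    x ⬝ᵥ G'.adjMatrix ℝ *ᵥ x < x ⬝ᵥ G.adjMatrix ℝ *ᵥ x := by
  have hle := ite_adj_le_ite_adj h.le fun i => (hx i).le
  obtain ⟨u, w, huw, huw'⟩ : ∃ u w, G.Adj u w ∧ ¬ G'.Adj u w := by
    by_contra! hno
    exact h.not_ge fun u w huw => hno u w huw
  simp only [dotProduct_adjMatrix_mulVec]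
  refine sum_lt_sum (fun i _ => sum_le_sum fun j _ => hle i j)
    ⟨u, mem_univ u, sum_lt_sum (fun j _ => hle u j) ⟨w, mem_univ w, ?_⟩⟩
  rw [if_neg huw', if_pos huw]
  exact mul_pos (hx u) (hx w)

end AdjMatrix

theorem adjSpectralRadius_lt {V : Type*} [Fintype V] {G' G : SimpleGraph V} (hG : G.Connected)
    (h : G' < G) : G'.adjSpectralRadius < G.adjSpectralRadius := by
  classical
  have := hG.nonempty
  obtain ⟨x, hx, hx0, hev⟩ :=
    exists_nonneg_mulVec_eq_spectralRadius_smul (G'.isHermitian_adjMatrix ℝ)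
    fun i j => by rw [SimpleGraph.adjMatrix_apply]; positivity
  have hform : x ⬝ᵥ G'.adjMatrix ℝ *ᵥ x = G'.adjSpectralRadius.toReal * (x ⬝ᵥ x) := by
    rw [hev, dotProduct_smul, smul_eq_mul]
    rfl
  by_contra! hle
  have hle' : G.adjSpectralRadius.toReal * (x ⬝ᵥ x) ≤ x ⬝ᵥ G'.adjMatrix ℝ *ᵥ x := by
    rw [hform]
    exact mul_le_mul_of_nonneg_right (ENNReal.toReal_mono (spectralRadius_ne_top _) hle)
      (dotProduct_star_self_nonneg x)
  -- The Perron vector of `G'` is an eigenvector of `G`, hence positive.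
  have hevG := mulVec_eq_of_spectralRadius_mul_le (G.isHermitian_adjMatrix ℝ)
    (hle'.trans (dotProduct_adjMatrix_mulVec_mono h.le hx))
  have hlt := dotProduct_adjMatrix_mulVec_strictMono h
    (pos_of_adjMatrix_mulVec_eq_smul hG hx hx0 hevG)
  have hleG := dotProduct_mulVec_le_spectralRadius_mul (G.isHermitian_adjMatrix ℝ) x
  exact (hlt.trans_le hleG).not_ge hle'

theorem eq_of_isMinSpectralRadius_of_le {V : Type*} [Fintype V] {r : ℕ} {H G : SimpleGraph V}
    (hG : G.IsMinSpectralRadius r) (hH : H.Connected) (hr : H.adjRank = r) (hle : H ≤ G) :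
    G = H :=
  (eq_or_lt_of_le hle).elim Eq.symm fun hlt =>
    absurd (adjSpectralRadius_lt hG.1 hlt) (hG.2.2 H hH hr).not_gt

section Rank

variable {K m n ι : Type*} [Field K] [Fintype n]

theorem rank_lt_card_of_mulVec_eq_zero {A : Matrix m n K} {x : n → K} (hx : x ≠ 0)
    (h : A *ᵥ x = 0) : A.rank < Fintype.card n := by
  have hker : 0 < Module.finrank K (LinearMap.ker A.mulVecLin) := by
    rw [Module.finrank_pos_iff, nontrivial_iff_exists_ne 0]
    exact ⟨⟨x, h⟩, fun h0 => hx (congrArg Subtype.val h0)⟩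
  have := A.mulVecLin.finrank_range_add_finrank_ker
  rw [Module.finrank_fintype_fun_eq_card] at this
  exact (Nat.lt_add_of_pos_right hker).trans_eq this

variable [Fintype ι]

theorem exists_eq_mul_submatrix [Finite m] {A : Matrix m n K} {e : ι → m}
    (h : (A.submatrix e id).rank = A.rank) : ∃ Q : Matrix m ι K, A = Q * A.submatrix e id := by
  have hspan : Submodule.span K (Set.range (A.row ∘ e)) = Submodule.span K (Set.range A.row) := by
    refine Submodule.eq_of_le_of_finrank_eq
      (Submodule.span_mono (Set.range_comp_subset_range _ _)) ?_
    rw [← rank_eq_finrank_span_row, ← h, rank_eq_finrank_span_row]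
    rfl
  have hmem (i : m) : A.row i ∈ Submodule.span K (Set.range (A.row ∘ e)) :=
    hspan ▸ Submodule.subset_span ⟨i, rfl⟩
  choose Q hQ using fun i => (Submodule.mem_span_range_iff_exists_fun K).1 (hmem i)
  refine ⟨of Q, ext fun i j => ?_⟩
  simpa [mul_apply] using (congrFun (hQ i) j).symm

theorem exists_rank_submatrix_id_eq [Finite m] (A : Matrix m n K) :
    ∃ e : Fin A.rank → m, (A.submatrix e id).rank = A.rank := by
  obtain ⟨κ, a, hinj, hspan, hli⟩ := exists_linearIndependent' K A.row
  have : Finite κ := Finite.of_injective a hinj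
  have : Fintype κ := Fintype.ofFinite κ
  have hcard : Fintype.card κ = A.rank := by
    rw [rank_eq_finrank_span_row, ← hspan, finrank_span_eq_card hli]
  let f := (Fintype.equivFinOfCardEq hcard).symm
  refine ⟨a ∘ f, ?_⟩
  simpa using (hli.comp f f.injective).rank_matrix (M := A.submatrix (a ∘ f) id)

theorem exists_rank_submatrix_eq_of_isSymm {A : Matrix n n K} (hA : A.IsSymm) :
    ∃ e : Fin A.rank → n, (A.submatrix e e).rank = A.rank := by
  obtain ⟨e, he⟩ := exists_rank_submatrix_id_eq A
  obtain ⟨Q, hQ⟩ := exists_eq_mul_submatrix he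
  refine ⟨e, le_antisymm (rank_submatrix_le A e e) ?_⟩
  have hQ' : A.submatrix e id = A.submatrix e e * Qᵀ := by
    have hQe : A.submatrix id e = Q * A.submatrix e e := congrArg (submatrix · id e) hQ
    rw [← (hA.submatrix e).eq, ← transpose_mul, ← hQe, transpose_submatrix, hA.eq]
  calc A.rank = (Q * (A.submatrix e e * Qᵀ)).rank := by rw [← hQ', ← hQ]
    _ ≤ (A.submatrix e e).rank := (rank_mul_le_right _ _).trans (rank_mul_le_left _ _)

variable [DecidableEq ι]

theorem isUnit_iff_rank_eq_card {A : Matrix ι ι K} : IsUnit A ↔ A.rank = Fintype.card ι := by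
  refine ⟨rank_of_isUnit A, fun h => ?_⟩
  by_contra hA
  rw [isUnit_iff_isUnit_det, isUnit_iff_ne_zero, not_not] at hA
  obtain ⟨x, hx, hAx⟩ := exists_mulVec_eq_zero_iff.2 hA
  exact (rank_lt_card_of_mulVec_eq_zero hx hAx).ne h

theorem eq_submatrix_mul_inv_mul_submatrix [Finite m] {A : Matrix m n K} {e : ι → m}
    {f : ι → n} (hA : A.rank = Fintype.card ι) (hef : (A.submatrix e f).rank = Fintype.card ι) :
    A = A.submatrix id f * (A.submatrix e f)⁻¹ * A.submatrix e id := by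
  have he : (A.submatrix e id).rank = A.rank := le_antisymm (rank_submatrix_le A e id) <| by
    rw [hA, ← hef]
    exact rank_submatrix_le (A.submatrix e id) id f
  obtain ⟨Q, hQ⟩ := exists_eq_mul_submatrix he
  have hQf : A.submatrix id f = Q * A.submatrix e f := congrArg (submatrix · id f) hQ
  have hdet := (isUnit_iff_isUnit_det _).1 (isUnit_iff_rank_eq_card.2 hef)
  rw [hQf, mul_nonsing_inv_cancel_right _ _ hdet, ← hQ]

/-- Basis exchange: the coefficient is that of row `e i` in the expansion of row `v` in the rows
with indices in the range of `e`. -/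
theorem rank_submatrix_update_eq_card {A : Matrix n n K} (hA : A.IsSymm) {e : ι → n}
    (hr : A.rank = Fintype.card ι) (he : (A.submatrix e e).rank = Fintype.card ι) {i : ι} {v : n}
    (h : (A.submatrix id e * (A.submatrix e e)⁻¹) v i ≠ 0) :
    (A.submatrix (Function.update e i v) (Function.update e i v)).rank = Fintype.card ι := by
  set P := A.submatrix id e * (A.submatrix e e)⁻¹
  set e' := Function.update e i v
  have hunit := isUnit_iff_rank_eq_card.2 he
  have hdet := (isUnit_iff_isUnit_det _).1 hunit
  have hPe : P * A.submatrix e e = A.submatrix id e := nonsing_inv_mul_cancel_right _ _ hdet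
  have hA' : A = P * A.submatrix e e * Pᵀ := by
    conv_lhs => rw [eq_submatrix_mul_inv_mul_submatrix hr he]
    rw [hPe, transpose_mul, transpose_submatrix, transpose_nonsing_inv, (hA.submatrix e).eq, hA.eq,
      ← Matrix.mul_assoc]
  have hPe' : P.submatrix e' id = updateRow 1 i (∑ k, P v k • (1 : Matrix ι ι K) k) := by
    ext j k
    rcases eq_or_ne j i with rfl | hji
    · simp [e', one_apply]
    · have hPone : P.submatrix e id = 1 := mul_nonsing_inv _ hdet
      simpa [e', hji] using congrFun (congrFun hPone j) k
  have hPdet : (P.submatrix e' id).det = P v i := by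
    rw [hPe', det_updateRow_sum, det_one, smul_eq_mul, mul_one]
  have hAe' : A.submatrix e' e' = P.submatrix e' id * A.submatrix e e * (P.submatrix e' id)ᵀ :=
    congrArg (submatrix · e' e') hA'
  rw [← isUnit_iff_rank_eq_card, isUnit_iff_isUnit_det, hAe', det_mul, det_mul, det_transpose,
    hPdet]
  exact (h.isUnit.mul hdet).mul h.isUnit

end Rank

section BlowUp

variable {V W : Type*}

theorem adjMatrix_comap {R : Type*} [Zero R] [One R] (H : SimpleGraph W) (g : V → W)
    [DecidableRel H.Adj] [DecidableRel (H.comap g).Adj] :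
    (H.comap g).adjMatrix R = (H.adjMatrix R).submatrix g g := by
  ext
  simp [SimpleGraph.adjMatrix_apply]

theorem connected_comap_of_surjective [Nontrivial W] {H : SimpleGraph W} (hH : H.Connected)
    {g : V → W} (hg : g.Surjective) : (H.comap g).Connected := by
  have hσ := Function.surjInv_eq hg
  have reachable_of_map_eq {u v : V} (huv : g u = g v) : (H.comap g).Reachable u v := by
    obtain ⟨c, hc⟩ := hH.preconnected.exists_adj_of_nontrivial (g u)
    obtain ⟨w, rfl⟩ := hg c
    have hu : (H.comap g).Adj u w := hc
    have hv : (H.comap g).Adj w v := (huv ▸ hc).symm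
    exact hu.reachable.trans hv.reachable
  let σ : H →g H.comap g := ⟨Function.surjInv hg, fun {a b} hab => by simpa [hσ] using hab⟩
  have : Nonempty V := (hg hH.nonempty.some).nonempty
  refine (SimpleGraph.connected_iff _).2 ⟨fun u v => ?_, this⟩
  exact (reachable_of_map_eq (hσ (g u)).symm).trans <|
    ((hH.preconnected (g u) (g v)).map σ).trans (reachable_of_map_eq (hσ (g v)))

variable [Fintype V] [Fintype W]

theorem adjRank_eq_rank (G : SimpleGraph V) [DecidableRel G.Adj] :
    G.adjRank = (G.adjMatrix ℝ).rank := by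
  unfold SimpleGraph.adjRank
  congr!

theorem adjRank_comap_le (H : SimpleGraph W) (g : V → W) : (H.comap g).adjRank ≤ H.adjRank := by
  classical
  rw [adjRank_eq_rank, adjRank_eq_rank, adjMatrix_comap]
  exact rank_submatrix_le _ g g

theorem adjRank_comap_of_surjective (H : SimpleGraph W) {g : V → W} (hg : g.Surjective) :
    (H.comap g).adjRank = H.adjRank := by
  refine le_antisymm (adjRank_comap_le H g) ?_
  have h := adjRank_comap_le (H.comap g) (Function.surjInv hg)
  rwa [SimpleGraph.comap_comap, (Function.rightInverse_surjInv hg).comp_eq_id,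
    SimpleGraph.comap_id] at h

theorem comap_mem_mulSet (H : SimpleGraph W) {g : V → W} (hg : g.Surjective) :
    H.comap g ∈ SimpleGraph.mulSet V (Fintype.card V) H := by
  classical
  let m (i : W) : ℕ := Fintype.card {v // g v = i}
  let E : V ≃ Σ i, Fin (m i) :=
    (Equiv.sigmaFiberEquiv g).symm.trans (Equiv.sigmaCongrRight fun i => Fintype.equivFin _)
  refine ⟨m, fun i => ?_, by simp [Fintype.card_congr E], ⟨⟨E, Iff.rfl⟩⟩⟩
  obtain ⟨v, hv⟩ := hg i
  exact Fintype.card_pos_iff.2 ⟨v, hv⟩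

theorem mem_mulSet_of_comap_le {r : ℕ} {G : SimpleGraph V} {H : SimpleGraph W}
    (hG : G.IsMinSpectralRadius r) [Nontrivial W] (hH : H.Connected)
    (hr : H.adjRank = r) {g : V → W} (hg : g.Surjective) (hle : H.comap g ≤ G) :
    G ∈ SimpleGraph.mulSet V (Fintype.card V) H := by
  rw [eq_of_isMinSpectralRadius_of_le hG (connected_comap_of_surjective hH hg)
    ((adjRank_comap_of_surjective H hg).trans hr) hle]
  exact comap_mem_mulSet H hg

end BlowUp

section Skeleton

variable {V ι : Type*} [Fintype ι] {G : SimpleGraph V} {e : ι → V}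

open scoped Classical in
/-- The trace of a vertex `v` on the family of vertices `e`: the indices of its neighbours. -/
noncomputable def trace (G : SimpleGraph V) (e : ι → V) (v : V) : Finset ι :=
  {i | G.Adj v (e i)}

/-- The value `1_Sᵀ N 1_T` of the bilinear form `N` at two indicator vectors. -/
def form (N : Matrix ι ι ℤ) (S T : Finset ι) : ℤ := ∑ j ∈ T, ∑ i ∈ S, N i j

theorem mem_trace {v : V} {i : ι} : i ∈ trace G e v ↔ G.Adj v (e i) := by
  simp [trace]

theorem trace_apply {F : SimpleGraph ι} [DecidableRel F.Adj] (he : G.comap e = F) (i : ι) :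
    trace G e (e i) = F.neighborFinset i := by
  subst he
  ext
  simp [mem_trace]

variable [DecidableEq ι] {F : SimpleGraph ι} [DecidableRel F.Adj] {N : Matrix ι ι ℤ} {d : ℤ}

theorem adjMatrix_mul_smul_map_intCast (hd : d ≠ 0) (hN : F.adjMatrix ℤ * N = d • 1) :
    F.adjMatrix ℝ * ((d : ℝ)⁻¹ • N.map (Int.cast : ℤ → ℝ)) = 1 := by
  have hF : F.adjMatrix ℝ = (F.adjMatrix ℤ).map (Int.castRingHom ℝ) := by
    ext
    simp [SimpleGraph.adjMatrix_apply]
  rw [hF, Matrix.mul_smul, inv_smul_eq_iff₀ (by exact_mod_cast hd)]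
  refine (Matrix.map_mul (f := Int.castRingHom ℝ)).symm.trans ?_
  rw [hN]
  ext i j
  rw [Matrix.map_apply, Matrix.smul_apply, Matrix.smul_apply, one_apply, one_apply]
  split_ifs <;> simp

theorem adjRank_eq_card (hd : d ≠ 0) (hN : F.adjMatrix ℤ * N = d • 1) :
    F.adjRank = Fintype.card ι := by
  rw [adjRank_eq_rank, ← isUnit_iff_rank_eq_card]
  exact IsUnit.of_mul_eq_one _ (adjMatrix_mul_smul_map_intCast hd hN)

theorem adjMatrix_submatrix_mul_inv_apply (he : G.comap e = F) (hd : d ≠ 0)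
    (hN : F.adjMatrix ℤ * N = d • 1) [DecidableRel G.Adj] (v : V) (i : ι) :
    ((G.adjMatrix ℝ).submatrix id e * ((G.adjMatrix ℝ).submatrix e e)⁻¹) v i =
      (d : ℝ)⁻¹ * ∑ j ∈ trace G e v, N j i := by
  subst he
  rw [← adjMatrix_comap, inv_eq_right_inv (adjMatrix_mul_smul_map_intCast hd hN), Matrix.mul_smul]
  simp [mul_apply, SimpleGraph.adjMatrix_apply, ← mem_trace, mul_sum]

variable [Fintype V]

theorem form_trace_trace (hG : G.adjRank = Fintype.card ι) (he : G.comap e = F) (hd : d ≠ 0)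
    (hN : F.adjMatrix ℤ * N = d • 1) [DecidableRel G.Adj] (u v : V) :
    form N (trace G e u) (trace G e v) = if G.Adj u v then d else 0 := by
  have hFr : ((G.adjMatrix ℝ).submatrix e e).rank = Fintype.card ι := by
    subst he
    rw [← adjMatrix_comap, ← adjRank_eq_rank, adjRank_eq_card hd hN]
  have hA := congrFun (congrFun (eq_submatrix_mul_inv_mul_submatrix
    ((adjRank_eq_rank G).symm.trans hG) hFr) u) v
  rw [Matrix.mul_apply] at hA
  simp only [adjMatrix_submatrix_mul_inv_apply he hd hN] at hA
  have hd' : (d : ℝ) ≠ 0 := by exact_mod_cast hd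
  have key : (form N (trace G e u) (trace G e v) : ℝ) = d * G.adjMatrix ℝ u v := by
    rw [hA, form, Int.cast_sum, mul_sum]
    simp [SimpleGraph.adjMatrix_apply, G.adj_comm, ← mem_trace, hd']
  rw [SimpleGraph.adjMatrix_apply] at key
  split_ifs at key ⊢ <;> simpa using key
theorem nontrivial_of_adjRank_ne_zero (h : G.adjRank ≠ 0) : Nontrivial V := by
  classical
  by_contra hV
  rw [not_nontrivial_iff_subsingleton] at hV
  refine h ?_
  have : G.adjMatrix ℝ = 0 := by
    ext u v
    simp [Subsingleton.elim u v]
  rw [adjRank_eq_rank, this, rank_zero]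

theorem trace_nonempty [Nontrivial V] (hG : G.adjRank = Fintype.card ι) (hconn : G.Connected)
    (he : G.comap e = F) (hd : d ≠ 0) (hN : F.adjMatrix ℤ * N = d • 1) (v : V) :
    (trace G e v).Nonempty := by
  classical
  obtain ⟨w, hvw⟩ := hconn.preconnected.exists_adj_of_nontrivial v
  rw [nonempty_iff_ne_empty]
  intro h
  have := form_trace_trace hG he hd hN v w
  rw [if_pos hvw, h] at this
  exact hd (by simpa [form] using this.symm)

theorem adjRank_comap_update (hG : G.adjRank = Fintype.card ι) (he : G.comap e = F) (hd : d ≠ 0)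
    (hN : F.adjMatrix ℤ * N = d • 1) {i : ι} {v : V} (h : ∑ j ∈ trace G e v, N j i ≠ 0) :
    (G.comap (Function.update e i v)).adjRank = Fintype.card ι := by
  classical
  rw [adjRank_eq_rank, adjMatrix_comap]
  refine rank_submatrix_update_eq_card G.isSymm_adjMatrix ((adjRank_eq_rank G).symm.trans hG) ?_ ?_
  · subst he
    rw [← adjMatrix_comap, ← adjRank_eq_rank, adjRank_eq_card hd hN]
  · rw [adjMatrix_submatrix_mul_inv_apply he hd hN]
    exact mul_ne_zero (inv_ne_zero (by exact_mod_cast hd)) (by exact_mod_cast h)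

end Skeleton

section SparseBasis

theorem deleteIncidenceSet_comap_update {V ι : Type*} [DecidableEq ι] (G : SimpleGraph V)
    (e : ι → V) (i : ι) (v : V) :
    (G.comap (Function.update e i v)).deleteIncidenceSet i =
      (G.comap e).deleteIncidenceSet i := by
  ext j k
  simp only [SimpleGraph.deleteIncidenceSet_adj, SimpleGraph.comap_adj]
  refine and_congr_left fun ⟨hj, hk⟩ => ?_
  rw [Function.update_of_ne hj, Function.update_of_ne hk]

variable {V ι : Type*} [Fintype ι] {G : SimpleGraph V} {e : ι → V}

/-- The family `e` of vertices induces a graph of full rank that has as few edges as possible. -/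
def IsSparseBasis (G : SimpleGraph V) (e : ι → V) : Prop :=
  (G.comap e).adjRank = Fintype.card ι ∧ ∀ e' : ι → V,
    (G.comap e').adjRank = Fintype.card ι →
      (G.comap e).edgeSet.ncard ≤ (G.comap e').edgeSet.ncard

theorem IsSparseBasis.comp_equiv (he : IsSparseBasis G e) (s : ι ≃ ι) :
    IsSparseBasis G (e ∘ s) := by
  have iso := SimpleGraph.Iso.comap s (G.comap e)
  rw [IsSparseBasis, ← SimpleGraph.comap_comap]
  refine ⟨(adjRank_comap_of_surjective _ s.surjective).trans he.1, fun e' he' => ?_⟩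
  exact (Nat.card_congr iso.mapEdgeSet).trans_le (he.2 e' he')

theorem exists_isSparseBasis [Fintype V] (hG : G.adjRank = Fintype.card ι) :
    ∃ e : ι → V, IsSparseBasis G e := by
  classical
  obtain ⟨e, he⟩ := exists_rank_submatrix_eq_of_isSymm (G.isSymm_adjMatrix (α := ℝ))
  let f : ι ≃ Fin (G.adjMatrix ℝ).rank :=
    Fintype.equivFinOfCardEq (hG.symm.trans (adjRank_eq_rank G))
  have hne : {e : ι → V | (G.comap e).adjRank = Fintype.card ι}.Nonempty := by
    refine ⟨e ∘ f, ?_⟩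
    rw [Set.mem_ofPred_eq, ← SimpleGraph.comap_comap, adjRank_comap_of_surjective _ f.surjective,
      adjRank_eq_rank, adjMatrix_comap, he, ← adjRank_eq_rank, hG]
  exact Set.exists_min_image _ (fun e => (G.comap e).edgeSet.ncard) (Set.toFinite _) hne

theorem ncard_edgeSet_eq (K : SimpleGraph ι) [DecidableRel K.Adj] (i : ι) :
    K.edgeSet.ncard = (K.deleteIncidenceSet i).edgeSet.ncard + K.degree i := by
  classical
  rw [K.edgeSet_deleteIncidenceSet, ← K.card_incidenceFinset_eq_degree, ← Set.ncard_coe_finset,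
    K.coe_incidenceFinset, Set.ncard_sdiff_add_ncard_of_subset (K.incidenceSet_subset i)]

variable [DecidableEq ι]

theorem degree_comap_update (i : ι) (v : V) [DecidableRel (G.comap (Function.update e i v)).Adj] :
    (G.comap (Function.update e i v)).degree i = #((trace G e v).erase i) := by
  rw [← SimpleGraph.card_neighborFinset_eq_degree]
  congr 1
  ext j
  rcases eq_or_ne j i with rfl | hji <;> simp_all [mem_trace]

variable {F : SimpleGraph ι} [DecidableRel F.Adj] {N : Matrix ι ι ℤ} {d : ℤ}
variable [Fintype V]

theorem IsSparseBasis.degree_le (hG : G.adjRank = Fintype.card ι) (hs : IsSparseBasis G e)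
    (he : G.comap e = F) (hd : d ≠ 0) (hN : F.adjMatrix ℤ * N = d • 1) {i : ι} {v : V}
    (h : ∑ j ∈ trace G e v, N j i ≠ 0) : F.degree i ≤ #((trace G e v).erase i) := by
  classical
  have hle := hs.2 _ (adjRank_comap_update hG he hd hN h)
  subst he
  rw [ncard_edgeSet_eq (G.comap e) i, ncard_edgeSet_eq (G.comap (Function.update e i v)) i,
    deleteIncidenceSet_comap_update, degree_comap_update] at hle
  exact Nat.le_of_add_le_add_left hle

end SparseBasis

section BlowUpInside

variable {V ι W : Type*} [Fintype V] [Fintype ι] [DecidableEq ι] {G : SimpleGraph V} {e : ι → V}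
  {F : SimpleGraph ι} [DecidableRel F.Adj] {N : Matrix ι ι ℤ} {d : ℤ}

/-- What is needed of the trace `S` of a vertex on a sparse basis that induces the graph `F`, where
`N` is a multiple of the inverse of the adjacency matrix of `F`. In the last condition, the sum
does not vanish exactly when replacing `i` by that vertex gives a basis. -/
def Admissible (F : SimpleGraph ι) [DecidableRel F.Adj] (N : Matrix ι ι ℤ) (S : Finset ι) : Prop :=
  S.Nonempty ∧ form N S S = 0 ∧ ∀ i, ∑ j ∈ S, N j i ≠ 0 → F.degree i ≤ #(S.erase i)

instance : DecidablePred (Admissible F N) := fun S =>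
  inferInstanceAs (Decidable (S.Nonempty ∧ form N S S = 0 ∧ ∀ _, _ → _))

theorem form_trace_self (hG : G.adjRank = Fintype.card ι) (he : G.comap e = F) (hd : d ≠ 0)
    (hN : F.adjMatrix ℤ * N = d • 1) (v : V) : form N (trace G e v) (trace G e v) = 0 := by
  classical
  rw [form_trace_trace hG he hd hN, if_neg (G.irrefl (v := v))]

theorem admissible_trace [Nontrivial V] (hG : G.adjRank = Fintype.card ι) (hconn : G.Connected)
    (hs : IsSparseBasis G e) (he : G.comap e = F) (hd : d ≠ 0) (hN : F.adjMatrix ℤ * N = d • 1)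
    (v : V) : Admissible F N (trace G e v) :=
  ⟨trace_nonempty hG hconn he hd hN v, form_trace_self hG he hd hN v,
    fun _ => hs.degree_le hG he hd hN⟩

theorem comap_trace_le (hG : G.adjRank = Fintype.card ι) (he : G.comap e = F) (hd : d ≠ 0)
    (hN : F.adjMatrix ℤ * N = d • 1) {P : Finset ι → Prop} (hP : ∀ v, P (trace G e v))
    {H : SimpleGraph W} {c : Finset ι → W}
    (hc : ∀ S, P S → ∀ T, P T → H.Adj (c S) (c T) → form N S T ≠ 0) :
    H.comap (fun v => c (trace G e v)) ≤ G := by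
  classical
  intro u v huv
  by_contra h
  refine hc _ (hP u) _ (hP v) huv ?_
  rw [form_trace_trace hG he hd hN, if_neg h]

end BlowUpInside

section FiveVertices

theorem exists_perm_forall_adj {ι : Type*} [Fintype ι] {F : SimpleGraph ι}
    (hF : F.adjRank = Fintype.card ι) : ∃ σ : Equiv.Perm ι, ∀ i, F.Adj (σ i) i := by
  classical
  rw [adjRank_eq_rank, ← isUnit_iff_rank_eq_card, isUnit_iff_isUnit_det, isUnit_iff_ne_zero,
    det_apply] at hF
  obtain ⟨σ, -, hσ⟩ := exists_ne_zero_of_sum_ne_zero hF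
  refine ⟨σ, fun i => ?_⟩
  by_contra hi
  exact hσ (by rw [prod_eq_zero (mem_univ i) (by simp [hi]), smul_zero])

theorem adjRank_lt_card {ι : Type*} [Fintype ι] {F : SimpleGraph ι} [DecidableRel F.Adj]
    {x : ι → ℤ} (hx : x ≠ 0) (h : F.adjMatrix ℤ *ᵥ x = 0) : F.adjRank < Fintype.card ι := by
  rw [adjRank_eq_rank]
  refine rank_lt_card_of_mulVec_eq_zero (x := fun i => (x i : ℝ)) (fun h0 => hx ?_) ?_
  · ext i
    simpa using congrFun h0 i
  · ext i
    have hi := congrFun h i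
    rw [SimpleGraph.adjMatrix_mulVec_apply] at hi ⊢
    simpa using congrArg (Int.cast : ℤ → ℝ) hi

/-- The graph on five vertices with the given edges, which in contrast to
`SimpleGraph.fromEdgeSet` is cheap to evaluate. -/
def ofPairs (l : List (Fin 5 × Fin 5)) : SimpleGraph (Fin 5) := .fromRel fun i j => (i, j) ∈ l

instance (l : List (Fin 5 × Fin 5)) : DecidableRel (ofPairs l).Adj := fun i j =>
  inferInstanceAs (Decidable (i ≠ j ∧ ((i, j) ∈ l ∨ (j, i) ∈ l)))

/-- The disjoint union of a triangle and an edge. -/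
def triangleEdge : SimpleGraph (Fin 5) := ofPairs [(0, 1), (0, 2), (1, 2), (3, 4)]

instance : DecidableRel triangleEdge.Adj :=
  inferInstanceAs (DecidableRel (ofPairs _).Adj)

instance : DecidableRel reducedG7.Adj :=
  fun _ _ => decidable_of_iff' _ SimpleGraph.cycleGraph_adj

/-- The edges of `reducedG1`. -/
def pairsG1 : List (Fin 5 × Fin 5) := [(0, 1), (0, 2), (0, 3), (1, 3), (2, 4)]

/-- The pairs of distinct vertices that are not adjacent in `reducedG1`. -/
def nonPairsG1 : List (Fin 5 × Fin 5) := [(0, 4), (1, 2), (1, 4), (2, 3), (3, 4)]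

/-- The graph obtained from `reducedG1` by adding the edges in `E`. -/
def overG1 (E : List (Fin 5 × Fin 5)) : SimpleGraph (Fin 5) := ofPairs (pairsG1 ++ E)

instance (E : List (Fin 5 × Fin 5)) : DecidableRel (overG1 E).Adj :=
  inferInstanceAs (DecidableRel (ofPairs _).Adj)

/-- The sets of edges to be added to `reducedG1` in order to obtain the nonsingular graphs over
`reducedG1`, one for each isomorphism class. -/
def extensionsG1 : List (List (Fin 5 × Fin 5)) :=
  [[], [(1, 2)], [(0, 4)], [(1, 2), (2, 3)], [(0, 4), (1, 2)], [(0, 4), (1, 2), (1, 4)],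
    nonPairsG1]

theorem reducedG1_eq_overG1 : reducedG1 = overG1 [] := by
  ext i j
  simp only [reducedG1, SimpleGraph.fromEdgeSet_adj, Set.mem_insert_iff, Set.mem_singleton_iff]
  revert i j
  decide

theorem exists_perm_of_forall_ne : ∀ σ : Equiv.Perm (Fin 5), (∀ i, σ i ≠ i) →
    ∃ s : Equiv.Perm (Fin 5), (∀ i j, reducedG7.Adj i j → σ (s i) = s j ∨ σ (s j) = s i) ∨
      ∀ i j, triangleEdge.Adj i j → σ (s i) = s j ∨ σ (s j) = s i := by
  decide +kernel

theorem exists_perm_reducedG7_edge : ∀ a b, a ≠ b → reducedG7.Adj a b ∨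
    ∃ s : Equiv.Perm (Fin 5), ∀ i j, (overG1 []).Adj i j →
      reducedG7.Adj (s i) (s j) ∨ s i = a ∧ s j = b ∨ s i = b ∧ s j = a := by
  decide +kernel

theorem exists_perm_triangleEdge_edge : ∀ a b, a ≠ b → triangleEdge.Adj a b ∨
    ∃ s : Equiv.Perm (Fin 5), ∀ i j, (overG1 []).Adj i j →
      triangleEdge.Adj (s i) (s j) ∨ s i = a ∧ s j = b ∨ s i = b ∧ s j = a := by
  decide +kernel

theorem exists_perm_overG1_iff_or_exists_mulVec_eq_zero : ∀ E ∈ nonPairsG1.sublists,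
    (∃ E' ∈ extensionsG1, E.length = E'.length ∧
      ∃ s : Equiv.Perm (Fin 5), ∀ i j, (overG1 E).Adj (s i) (s j) ↔ (overG1 E').Adj i j) ∨
    ∃ x : Fin 5 → Fin 3, x ≠ 1 ∧ (overG1 E).adjMatrix ℤ *ᵥ (fun i => (x i : ℤ) - 1) = 0 := by
  decide +kernel

variable {F : SimpleGraph (Fin 5)}

theorem exists_reducedG7_or_triangleEdge_le_comap (hF : F.adjRank = 5) :
    ∃ s : Equiv.Perm (Fin 5), reducedG7 ≤ F.comap s ∨ triangleEdge ≤ F.comap s := by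
  obtain ⟨σ, hσ⟩ := exists_perm_forall_adj (F := F) hF
  obtain ⟨s, hs⟩ := exists_perm_of_forall_ne σ fun i => (hσ i).ne
  have adj_of_eq {i j : Fin 5} (h : σ (s i) = s j ∨ σ (s j) = s i) : (F.comap s).Adj i j :=
    h.elim (fun h => SimpleGraph.comap_adj.2 (h ▸ (hσ (s i)).symm))
      fun h => SimpleGraph.comap_adj.2 (h ▸ hσ (s j))
  exact ⟨s, hs.imp (fun h i j hij => adj_of_eq (h i j hij)) fun h i j hij => adj_of_eq (h i j hij)⟩

theorem eq_or_exists_overG1_le_comap {K : SimpleGraph (Fin 5)}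
    (hK : ∀ a b, a ≠ b → K.Adj a b ∨ ∃ s : Equiv.Perm (Fin 5), ∀ i j, (overG1 []).Adj i j →
      K.Adj (s i) (s j) ∨ s i = a ∧ s j = b ∨ s i = b ∧ s j = a) (hKF : K ≤ F) :
    F = K ∨ ∃ s : Equiv.Perm (Fin 5), overG1 [] ≤ F.comap s := by
  refine or_iff_not_imp_left.2 fun hne => ?_
  obtain ⟨a, b, hab, hKab⟩ : ∃ a b, F.Adj a b ∧ ¬K.Adj a b := by
    by_contra! h
    exact hne (le_antisymm h hKF)
  obtain ⟨s, hs⟩ := (hK a b hab.ne).resolve_left hKab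
  refine ⟨s, fun i j hij => ?_⟩
  obtain h | ⟨hi, hj⟩ | ⟨hi, hj⟩ := hs i j hij
  · exact hKF h
  · simpa [hi, hj] using hab
  · simpa [hi, hj] using hab.symm

theorem overG1_adj {E : List (Fin 5 × Fin 5)} {i j : Fin 5} : (overG1 E).Adj i j ↔
    (overG1 []).Adj i j ∨ i ≠ j ∧ ((i, j) ∈ E ∨ (j, i) ∈ E) := by
  simp only [overG1, ofPairs, SimpleGraph.fromRel_adj, List.mem_append, List.append_nil]
  tauto

theorem exists_eq_overG1 (h : overG1 [] ≤ F) : ∃ E ∈ nonPairsG1.sublists, F = overG1 E := by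
  classical
  have adj_or_mem : ∀ i j : Fin 5, i ≠ j →
      (overG1 []).Adj i j ∨ (i, j) ∈ nonPairsG1 ∨ (j, i) ∈ nonPairsG1 := by decide
  refine ⟨nonPairsG1.filter fun p => F.Adj p.1 p.2,
    List.mem_sublists.2 List.filter_sublist, ?_⟩
  ext i j
  rw [overG1_adj]
  simp only [List.mem_filter, decide_eq_true_eq, F.adj_comm j i]
  refine ⟨fun hij => (adj_or_mem i j hij.ne).imp id fun hmem => ⟨hij.ne, ?_⟩, ?_⟩
  · simpa [hij, hij.symm] using hmem
  · rintro (hij | ⟨-, hij⟩)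
    · exact h hij
    · exact hij.elim And.right And.right

theorem exists_comap_eq_overG1 (hF : F.adjRank = 5) (h : overG1 [] ≤ F) :
    ∃ s : Equiv.Perm (Fin 5), ∃ E ∈ extensionsG1, F.comap s = overG1 E := by
  obtain ⟨E, hE, rfl⟩ := exists_eq_overG1 h
  obtain ⟨E', hE', -, s, hs⟩ | ⟨x, hx, hx0⟩ := exists_perm_overG1_iff_or_exists_mulVec_eq_zero E hE
  · exact ⟨s, E', hE', by ext i j; exact hs i j⟩
  · refine absurd hF (adjRank_lt_card (fun h0 => hx (funext fun i => Fin.ext ?_)) hx0).ne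
    exact_mod_cast sub_eq_zero.1 (congrFun h0 i)

theorem exists_comap_eq_reducedG7_or_triangleEdge_or_overG1 (hF : F.adjRank = 5) :
    ∃ s : Equiv.Perm (Fin 5), F.comap s = reducedG7 ∨ F.comap s = triangleEdge ∨
      ∃ E ∈ extensionsG1, F.comap s = overG1 E := by
  have exists_comap_eq_overG1_of_le {s t : Equiv.Perm (Fin 5)}
      (h : overG1 [] ≤ (F.comap s).comap t) :
      ∃ u : Equiv.Perm (Fin 5), ∃ E ∈ extensionsG1, F.comap u = overG1 E := by
    rw [SimpleGraph.comap_comap, ← Equiv.Perm.coe_mul] at h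
    obtain ⟨u, E, hE, hu⟩ := exists_comap_eq_overG1
      ((adjRank_comap_of_surjective F (s * t).surjective).trans hF) h
    exact ⟨s * t * u, E, hE, by rwa [Equiv.Perm.coe_mul _ u, ← SimpleGraph.comap_comap]⟩
  obtain ⟨s, hs | hs⟩ := exists_reducedG7_or_triangleEdge_le_comap hF
  · obtain h | ⟨t, ht⟩ := eq_or_exists_overG1_le_comap exists_perm_reducedG7_edge hs
    · exact ⟨s, .inl h⟩
    · exact (exists_comap_eq_overG1_of_le ht).imp fun _ h => .inr (.inr h)
  · obtain h | ⟨t, ht⟩ := eq_or_exists_overG1_le_comap exists_perm_triangleEdge_edge hs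
    · exact ⟨s, .inr (.inl h)⟩
    · exact (exists_comap_eq_overG1_of_le ht).imp fun _ h => .inr (.inr h)

end FiveVertices

section ReducedGraphs

instance : DecidableRel reducedG10.Adj := by
  unfold reducedG10
  infer_instance

theorem connected_reducedG1 : reducedG1.Connected := by
  rw [reducedG1_eq_overG1]
  decide +kernel

theorem connected_reducedG7 : reducedG7.Connected :=
  ⟨SimpleGraph.cycleGraph_connected.preconnected⟩

theorem connected_reducedG10 : reducedG10.Connected := by
  decide +kernel

/-- The vertex of `H` to which a vertex with trace `S` on a copy of `F` belongs in a spanning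
blow-up of `H`: the vertex of `F` with neighbourhood `S`, if there is one, and otherwise the first
vertex of `H` with neighbourhood contained in `S`. -/
def blowUpClass (H F : SimpleGraph (Fin 5)) [DecidableRel H.Adj] [DecidableRel F.Adj]
    (S : Finset (Fin 5)) : Fin 5 :=
  ((List.finRange 5).find? fun i => F.neighborFinset i = S).getD
    (((List.finRange 5).find? fun i => H.neighborFinset i ⊆ S).getD 0)

/-- The finitely many conditions on `N`, a multiple of the inverse of the adjacency matrix of `F`,
which ensure that `blowUpClass H F` exhibits a spanning blow-up of `H` in each connected graph of
rank five with a sparse basis that induces `F`. -/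
def IsCertificate (H F : SimpleGraph (Fin 5)) [DecidableRel H.Adj] [DecidableRel F.Adj]
    (N : Matrix (Fin 5) (Fin 5) ℤ) (d : ℤ) : Prop :=
  d ≠ 0 ∧ F.adjMatrix ℤ * N = d • 1 ∧ (∀ w, ∃ i, blowUpClass H F (F.neighborFinset i) = w) ∧
    ∀ S, Admissible F N S → ∀ T, Admissible F N T →
      H.Adj (blowUpClass H F S) (blowUpClass H F T) → form N S T ≠ 0

instance (H F : SimpleGraph (Fin 5)) [DecidableRel H.Adj] [DecidableRel F.Adj]
    (N : Matrix (Fin 5) (Fin 5) ℤ) (d : ℤ) : Decidable (IsCertificate H F N d) := by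
  unfold IsCertificate
  infer_instance

theorem exists_isCertificate_overG1 : ∀ E ∈ extensionsG1,
    ∃ N d, IsCertificate (overG1 []) (overG1 E) N d := by
  simp only [extensionsG1, List.forall_mem_cons]
  refine ⟨⟨!![-1, 1, 0, 1, 1; 1, -1, 0, 1, -1; 0, 0, 0, 0, 2; 1, 1, 0, -1, -1; 1, -1, 2, -1, -1],
      2, by decide +kernel⟩,
    ⟨!![-1, 1, 0, 1, 0; 1, -1, 0, 1, 0; 0, 0, 0, 0, 2; 1, 1, 0, -1, -2; 0, 0, 2, -2, 0],
      2, by decide +kernel⟩,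
    ⟨!![-1, 1, 1, 1, 1; 1, -1, -1, 3, -1; 1, -1, -1, -1, 3; 1, 3, -1, -1, -1; 1, -1, 3, -1, -1],
      4, by decide +kernel⟩,
    ⟨!![-1, 1, 0, 1, -1; 1, -1, 0, 1, -1; 0, 0, 0, 0, 2; 1, 1, 0, -1, -1; -1, -1, 2, -1, 3],
      2, by decide +kernel⟩,
    ⟨!![-1, 1, 1, 0, 0; 1, -1, -1, 2, 0; 1, -1, -1, 0, 2; 0, 2, 0, 0, -2; 0, 0, 2, -2, 0],
      2, by decide +kernel⟩,
    ⟨!![-1, 1, 0, 1, 0; 1, -1, 0, 1, 0; 0, 0, 0, -2, 2; 1, 1, -2, 3, -2; 0, 0, 2, -2, 0],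
      2, by decide +kernel⟩,
    ⟨!![-3, 1, 1, 1, 1; 1, -3, 1, 1, 1; 1, 1, -3, 1, 1; 1, 1, 1, -3, 1; 1, 1, 1, 1, -3],
      4, by decide +kernel⟩, List.forall_mem_nil _⟩

theorem isCertificate_reducedG7 : IsCertificate reducedG7 reducedG7
    !![1, 1, -1, -1, 1; 1, 1, 1, -1, -1; -1, 1, 1, 1, -1; -1, -1, 1, 1, 1; 1, -1, -1, 1, 1] 2 := by
  decide +kernel

end ReducedGraphs

section SpanningBlowUps

theorem IsCertificate.adjRank_eq {H F : SimpleGraph (Fin 5)} [DecidableRel H.Adj]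
    [DecidableRel F.Adj] {N : Matrix (Fin 5) (Fin 5) ℤ} {d : ℤ} (h : IsCertificate H F N d) :
    F.adjRank = 5 :=
  adjRank_eq_card h.1 h.2.1

theorem adjRank_reducedG1 : reducedG1.adjRank = 5 := by
  obtain ⟨N, d, h⟩ := exists_isCertificate_overG1 [] List.mem_cons_self
  rw [reducedG1_eq_overG1, h.adjRank_eq]

theorem adjRank_reducedG10 : reducedG10.adjRank = 5 := by
  refine le_antisymm (Nat.le_of_lt_succ ?_) ?_
  · exact adjRank_lt_card (x := ![1, 0, 0, 0, -1, -1]) (by decide) (by decide +kernel)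
  · have h : reducedG10.comap ![0, 1, 3, 2, 5] = overG1 [] := by
      ext i j
      rw [SimpleGraph.comap_adj]
      revert i j
      decide +kernel
    rw [← adjRank_reducedG1, reducedG1_eq_overG1, ← h]
    exact adjRank_comap_le _ _

variable {V : Type*} [Fintype V] {G : SimpleGraph V} {e : Fin 5 → V}

theorem IsCertificate.exists_comap_le {H F : SimpleGraph (Fin 5)} [DecidableRel H.Adj]
    [DecidableRel F.Adj] {N : Matrix (Fin 5) (Fin 5) ℤ} {d : ℤ} (h : IsCertificate H F N d)
    (hG : G.adjRank = 5) (hconn : G.Connected) (hs : IsSparseBasis G e) (he : G.comap e = F) :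
    ∃ g : V → Fin 5, g.Surjective ∧ H.comap g ≤ G := by
  obtain ⟨hd, hN, hsurj, hadj⟩ := h
  have := nontrivial_of_adjRank_ne_zero (hG.trans_ne (by decide))
  refine ⟨fun v => blowUpClass H F (trace G e v), fun w => ?_,
    comap_trace_le hG he hd hN (admissible_trace hG hconn hs he hd hN) hadj⟩
  obtain ⟨i, hi⟩ := hsurj w
  exact ⟨e i, (congrArg _ (trace_apply he i)).trans hi⟩

/-- Twice the inverse of the adjacency matrix of `triangleEdge`. -/
def invTriangleEdge : Matrix (Fin 5) (Fin 5) ℤ :=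
  !![-1, 1, 1, 0, 0; 1, -1, 1, 0, 0; 1, 1, -1, 0, 0; 0, 0, 0, 0, 2; 0, 0, 0, 2, 0]

theorem adjMatrix_triangleEdge_mul : triangleEdge.adjMatrix ℤ * invTriangleEdge = (2 : ℤ) • 1 := by
  decide +kernel

theorem exists_automorphism_triangleEdge : ∀ S T : Finset (Fin 5),
    form invTriangleEdge S S = 0 → ¬Disjoint S {0, 1, 2} → Disjoint T {0, 1, 2} →
    form invTriangleEdge S T ≠ 0 → ∃ s : Equiv.Perm (Fin 5),
      (∀ i j, triangleEdge.Adj (s i) (s j) ↔ triangleEdge.Adj i j) ∧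
        ∀ i, s i ∈ S ↔ i ∈ ({0, 1, 3} : Finset (Fin 5)) := by
  decide +kernel

theorem exists_form_trace_ne_zero (hG : G.adjRank = 5) (hconn : G.Connected)
    (he : G.comap e = triangleEdge) : ∃ x y, ¬Disjoint (trace G e x) {0, 1, 2} ∧
      Disjoint (trace G e y) {0, 1, 2} ∧ form invTriangleEdge (trace G e x) (trace G e y) ≠ 0 := by
  classical
  obtain ⟨p⟩ := hconn.preconnected (e 0) (e 3)
  obtain ⟨a, -, ha, ha'⟩ := p.exists_boundary_dart {v | ¬Disjoint (trace G e v) {0, 1, 2}}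
    (by rw [Set.mem_ofPred_eq, trace_apply he]; decide)
    (by rw [Set.mem_ofPred_eq, trace_apply he]; decide)
  refine ⟨a.fst, a.snd, ha, not_not.1 ha', ?_⟩
  rw [form_trace_trace hG he two_ne_zero adjMatrix_triangleEdge_mul, if_pos a.adj]
  exact two_ne_zero

theorem exists_trace_eq_zero_one_three (hG : G.adjRank = 5) (hconn : G.Connected)
    (he : G.comap e = triangleEdge) : ∃ e' : Fin 5 → V, G.comap e' = triangleEdge ∧
      ∃ x, trace G e' x = {0, 1, 3} := by
  obtain ⟨x, y, hx, hy, hxy⟩ := exists_form_trace_ne_zero hG hconn he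
  obtain ⟨s, hs, hsx⟩ := exists_automorphism_triangleEdge _ _
    (form_trace_self hG he two_ne_zero adjMatrix_triangleEdge_mul x) hx hy hxy
  refine ⟨e ∘ s, ?_, x, ?_⟩
  · rw [← SimpleGraph.comap_comap, he]
    ext i j
    exact hs i j
  · ext i
    rw [← hsx i, mem_trace, mem_trace, Function.comp_apply]

/-- The vertex of `reducedG10` to which a vertex with trace `S` on a copy of `triangleEdge` belongs
in a spanning blow-up of `reducedG10`: the first one whose label, in the list below, is contained
in `S`. Vertex `0` stands for a vertex with trace `{0, 1, 3}` that joins the triangle to the edge,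
and the other labels are the neighbourhoods in `triangleEdge`. -/
def bridgeClass (S : Finset (Fin 5)) : Fin 6 :=
  ((List.finRange 6).find? fun i => ![{0, 1, 3}, {1, 2}, {0, 2}, {4}, {0, 1}, {3}] i ⊆ S).getD 5

/-- What is needed of the trace `S` of a vertex on a copy of `triangleEdge` if there is a vertex
with trace `{0, 1, 3}`. -/
def BridgeAdmissible (S : Finset (Fin 5)) : Prop :=
  S.Nonempty ∧ form invTriangleEdge S S = 0 ∧
    (form invTriangleEdge S {0, 1, 3} = 2 ∨ form invTriangleEdge S {0, 1, 3} = 0)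

instance : DecidablePred BridgeAdmissible := fun S =>
  inferInstanceAs (Decidable (S.Nonempty ∧ form _ S S = 0 ∧ (_ ∨ _)))

theorem form_ne_zero_of_adj_bridgeClass : ∀ S, BridgeAdmissible S → ∀ T, BridgeAdmissible T →
    reducedG10.Adj (bridgeClass S) (bridgeClass T) → form invTriangleEdge S T ≠ 0 := by
  decide +kernel

theorem eq_bridgeClass_or_exists : ∀ w, bridgeClass {0, 1, 3} = w ∨
    ∃ i, bridgeClass (triangleEdge.neighborFinset i) = w := by
  decide +kernel

theorem exists_comap_reducedG10_le (hG : G.adjRank = 5) (hconn : G.Connected)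
    (he : G.comap e = triangleEdge) : ∃ g : V → Fin 6, g.Surjective ∧ reducedG10.comap g ≤ G := by
  classical
  obtain ⟨e, he, x, hx⟩ := exists_trace_eq_zero_one_three hG hconn he
  have := nontrivial_of_adjRank_ne_zero (hG.trans_ne (by decide))
  have hN := adjMatrix_triangleEdge_mul
  have hP (v : V) : BridgeAdmissible (trace G e v) := by
    refine ⟨trace_nonempty hG hconn he two_ne_zero hN v, form_trace_self hG he two_ne_zero hN v, ?_⟩
    rw [← hx, form_trace_trace hG he two_ne_zero hN]
    exact ite_eq_or_eq _ _ _
  refine ⟨fun v => bridgeClass (trace G e v), fun w => ?_,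
    comap_trace_le hG he two_ne_zero hN hP form_ne_zero_of_adj_bridgeClass⟩
  obtain hw | ⟨i, hi⟩ := eq_bridgeClass_or_exists w
  · exact ⟨x, (congrArg bridgeClass hx).trans hw⟩
  · exact ⟨e i, (congrArg _ (trace_apply he i)).trans hi⟩

theorem exists_reducedG1_or_reducedG7_or_reducedG10_comap_le (hG : G.adjRank = 5)
    (hconn : G.Connected) :
    (∃ g : V → Fin 5, g.Surjective ∧ reducedG1.comap g ≤ G) ∨
      (∃ g : V → Fin 5, g.Surjective ∧ reducedG7.comap g ≤ G) ∨
        ∃ g : V → Fin 6, g.Surjective ∧ reducedG10.comap g ≤ G := by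
  obtain ⟨e, he⟩ := exists_isSparseBasis (ι := Fin 5) hG
  obtain ⟨s, hs⟩ := exists_comap_eq_reducedG7_or_triangleEdge_or_overG1 he.1
  rw [SimpleGraph.comap_comap] at hs
  obtain hs | hs | ⟨E, hE, hs⟩ := hs
  · exact .inr (.inl (isCertificate_reducedG7.exists_comap_le hG hconn (he.comp_equiv s) hs))
  · exact .inr (.inr (exists_comap_reducedG10_le hG hconn hs))
  · obtain ⟨N, d, h⟩ := exists_isCertificate_overG1 E hE
    rw [reducedG1_eq_overG1]
    exact .inl (h.exists_comap_le hG hconn (he.comp_equiv s) hs)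

end SpanningBlowUps

end RankFive

theorem proposition3p3 {V : Type*} [Fintype V] (n : ℕ) (hn : Fintype.card V = n)
    (G : SimpleGraph V) (hG : G.IsMinSpectralRadius 5) :
    G ∈ SimpleGraph.mulSet V n reducedG1 ∪ SimpleGraph.mulSet V n reducedG7 ∪
      SimpleGraph.mulSet V n reducedG10 := by
  open RankFive in
  subst hn
  obtain ⟨g, hg, hle⟩ | ⟨g, hg, hle⟩ | ⟨g, hg, hle⟩ :=
    exists_reducedG1_or_reducedG7_or_reducedG10_comap_le hG.2.1 hG.1
  · exact .inl (.inl (mem_mulSet_of_comap_le hG connected_reducedG1 adjRank_reducedG1 hg hle))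
  · exact .inl (.inr (mem_mulSet_of_comap_le hG connected_reducedG7
      isCertificate_reducedG7.adjRank_eq hg hle))
  · exact .inr (mem_mulSet_of_comap_le hG connected_reducedG10 adjRank_reducedG10 hg hle)
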